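/- Let $\mathcal V$ be the variety of groups defined by an arbitrary set $V$ of laws (words in the free group on countably many letters). For a group $X$ let $V(X)$ be the subgroup generated by all values in $X$ of words of $V$, and for a normal subgroup $M\trianglelefteq X$ let $[M\,V^*X]$ be the subgroup generated by all elements $$v(x_1,\dots,x_i m,\dots,x_r)\,v(x_1,\dots,x_i,\dots,x_r)^{-1}\qquad (v\in V,\ x_1,\dots,x_r\in X,\ 1\le i\le r,\ m\in M).$$ A free simplicial resolution of a group $G$ is a simplicial group $K_\bullet$ such that every $K_n$ is a free group, with bases that can be chosen so that the degeneracies send basis elements to basis elements, together with an isomorphism $\pi_0(K_\bullet)\cong G$, and such that $\pi_m(K_\bullet)=1$ for all $m\ge 1$. Here $\pi_n$ is the $n$-th homology group of the Moore complex $(NK)_n=\bigcap_{i<n}\ker d_i$, $\partial_n=d_n$. For a group $G$ with a normal subgroup $N$, choose free simplicial resolutions $K_\bullet$ of $G$ and $L_\bullet$ of $G/N$ and an epimorphism of simplicial groups (surjective in each degree) $\alpha:K_\bullet\to L_\bullet$ that induces the natural epimorphism $G\to G/N$ on $\pi_0$. Let $\alpha/V(\alpha):K_\bullet/V(K_\bullet)\to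 L_\bullet/V(L_\bullet)$ be the induced homomorphism, with kernel formed in each degree. The Baer invariant of the pair $(G,N)$ is $$\mathcal VM(G,N)=\pi_1\big(\ker(\alpha/V(\alpha))\big).$$ Corollary 3.4. Let $G$ be a group and let $N$ be a normal subgroup of $G$ that has a complement in $G$, that is, there is a subgroup $Q\le G$ with $G=NQ$ and $N\cap Q=1$. Let $F$ be a free group, let $p:F\to G$ be an epimorphism, and put $R=\ker p$ and $S=p^{-1}(N)$, so that $G\cong F/R$ and $N\cong S/R$. Then $(K_\bullet,L_\bullet,\alpha)$ as above exist, and for every choice of them there is an isomorphism of groups $$\mathcal VM(G,N)\;\cong\;\frac{R\cap[S\,V^*F]}{[R\,V^*F]}.$$ -/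

import Mathlib

universe u v

/-! ### Verbal subgroups and the subgroups `[N V* G]`

A variety of groups is given by a set of laws `V`, a set of words in the free group on countably
many letters `x₀, x₁, x₂, …`. The value of a word `v` at `(g₀, g₁, …)` is `FreeGroup.lift g v`. -/

section Verbal

variable {G : Type u} [Group G] {H : Type v} [Group H]

/-- The verbal subgroup `V(G)`: generated by all values in `G` of the words of `V`. -/
def verbalSubgroup (V : Set (FreeGroup ℕ)) (G : Type u) [Group G] : Subgroup G :=
  Subgroup.closure {x | ∃ w ∈ V, ∃ g : ℕ → G, x = FreeGroup.lift g w}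

/-- The subgroup `[N V* G]`: generated by all
`v(g₁, …, gᵢ n, …, gᵣ) v(g₁, …, gᵢ, …, gᵣ)⁻¹` with `v ∈ V`, `gⱼ ∈ G` and `n ∈ N`. -/
def starSubgroup (V : Set (FreeGroup ℕ)) (N : Subgroup G) : Subgroup G :=
  Subgroup.closure {x | ∃ w ∈ V, ∃ (g : ℕ → G) (i : ℕ), ∃ n ∈ N,
    x = FreeGroup.lift (Function.update g i (g i * n)) w * (FreeGroup.lift g w)⁻¹}

theorem map_lift_word (f : G →* H) (g : ℕ → G) (w : FreeGroup ℕ) :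
    f (FreeGroup.lift g w) = FreeGroup.lift (fun i => f (g i)) w := by
  have h : f.comp (FreeGroup.lift g) = FreeGroup.lift (fun i => f (g i)) := by
    ext i
    simp
  exact DFunLike.congr_fun h w

theorem verbalSubgroup_le_comap (V : Set (FreeGroup ℕ)) (f : G →* H) :
    verbalSubgroup V G ≤ (verbalSubgroup V H).comap f := by
  refine (Subgroup.closure_le _).2 ?_
  rintro x ⟨w, hw, g, rfl⟩
  exact Subgroup.subset_closure ⟨w, hw, fun i => f (g i), map_lift_word f g w⟩

instance verbalSubgroup_normal (V : Set (FreeGroup ℕ)) : (verbalSubgroup V G).Normal :=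
  ⟨fun _ hx g => verbalSubgroup_le_comap V (MulAut.conj g).toMonoidHom hx⟩

instance starSubgroup_normal (V : Set (FreeGroup ℕ)) (N : Subgroup G) [N.Normal] :
    (starSubgroup V N).Normal := by
  refine ⟨fun x hx h => ?_⟩
  have key : starSubgroup V N ≤ (starSubgroup V N).comap (MulAut.conj h).toMonoidHom := by
    refine (Subgroup.closure_le _).2 ?_
    rintro x ⟨w, hw, g, i, n, hn, rfl⟩
    refine Subgroup.subset_closure ⟨w, hw, fun j => MulAut.conj h (g j), i, MulAut.conj h n,
      Subgroup.Normal.conj_mem inferInstance n hn h, ?_⟩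
    rw [map_mul, map_inv, map_lift_word, map_lift_word]
    congr 2
    congr 1
    funext j
    by_cases hj : j = i
    · subst hj
      simp
    · simp [Function.update_of_ne hj]
  exact key hx

end Verbal

/-! ### Simplicial groups -/

/-- A simplicial group: groups `X₀, X₁, X₂, …` with face homomorphisms `dᵢ : Xₙ₊₁ → Xₙ`
(`0 ≤ i ≤ n + 1`) and degeneracy homomorphisms `sᵢ : Xₙ → Xₙ₊₁` (`0 ≤ i ≤ n`) that satisfy the
simplicial identities. -/
structure SimplicialGroup where
  obj : ℕ → Type u
  [group : ∀ n, Group (obj n)]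
  d : ∀ (n : ℕ), Fin (n + 2) → (obj (n + 1) →* obj n)
  s : ∀ (n : ℕ), Fin (n + 1) → (obj n →* obj (n + 1))
  /-- `dⱼ dᵢ₊₁ = dᵢ dⱼ` for `j < i + 1`. -/
  d_d : ∀ (n : ℕ) (i j : Fin (n + 2)), j ≤ i → ∀ x : obj (n + 2),
    d n j (d (n + 1) i.succ x) = d n i (d (n + 1) j.castSucc x)
  /-- `sⱼ sᵢ = sᵢ₊₁ sⱼ` for `j ≤ i`. -/
  s_s : ∀ (n : ℕ) (i j : Fin (n + 1)), j ≤ i → ∀ x : obj n,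
    s (n + 1) j.castSucc (s n i x) = s (n + 1) i.succ (s n j x)
  /-- `dⱼ sᵢ₊₁ = sᵢ dⱼ` for `j < i + 1`. -/
  d_s_of_lt : ∀ (n : ℕ) (i : Fin (n + 1)) (j : Fin (n + 2)), j ≤ i.castSucc → ∀ x : obj (n + 1),
    d (n + 1) j.castSucc (s (n + 1) i.succ x) = s n i (d n j x)
  /-- `dᵢ sᵢ = id`. -/
  d_s_self : ∀ (n : ℕ) (i : Fin (n + 1)) (x : obj n), d n i.castSucc (s n i x) = x
  /-- `dᵢ₊₁ sᵢ = id`. -/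
  d_s_succ : ∀ (n : ℕ) (i : Fin (n + 1)) (x : obj n), d n i.succ (s n i x) = x
  /-- `dⱼ₊₁ sᵢ = sᵢ dⱼ` for `j + 1 > i + 1`. -/
  d_s_of_gt : ∀ (n : ℕ) (i : Fin (n + 1)) (j : Fin (n + 2)), i.castSucc < j → ∀ x : obj (n + 1),
    d (n + 1) j.succ (s (n + 1) i.castSucc x) = s n i (d n j x)

attribute [instance] SimplicialGroup.group

namespace SimplicialGroup

/-- Homomorphisms of simplicial groups. -/
structure Hom (X Y : SimplicialGroup.{u}) where
  app : ∀ n, X.obj n →* Y.obj n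
  app_d : ∀ n i x, app n (X.d n i x) = Y.d n i (app (n + 1) x)
  app_s : ∀ n i x, app (n + 1) (X.s n i x) = Y.s n i (app n x)

/-- The subgroup of `n`-cycles of the Moore complex `(NX)ₙ = ⋂_{i < n} ker dᵢ`, `∂ₙ = dₙ`: the
elements of `Xₙ` all of whose faces are trivial. -/
def cycles (X : SimplicialGroup.{u}) : ∀ n, Subgroup (X.obj n)
  | 0 => ⊤
  | n + 1 => ⨅ i : Fin (n + 2), (X.d n i).ker

/-- The subgroup of `n`-boundaries of the Moore complex: the image of
`(NX)ₙ₊₁ = ⋂_{i < n + 1} ker dᵢ` under `∂ₙ₊₁ = dₙ₊₁`. -/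
def boundaries (X : SimplicialGroup.{u}) (n : ℕ) : Subgroup (X.obj n) :=
  (⨅ i : Fin (n + 1), (X.d n i.castSucc).ker).map (X.d n (Fin.last (n + 1)))

instance boundaries_normal (X : SimplicialGroup.{u}) (n : ℕ) : (X.boundaries n).Normal := by
  refine ⟨?_⟩
  rintro _ ⟨z, hz, rfl⟩ g
  refine ⟨X.s n (Fin.last n) g * z * (X.s n (Fin.last n) g)⁻¹, ?_, ?_⟩
  · simp only [SetLike.mem_coe, Subgroup.mem_iInf, MonoidHom.mem_ker] at hz ⊢
    intro i
    simp [hz i]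
  · have h := X.d_s_succ n (Fin.last n) g
    rw [Fin.succ_last] at h
    simp [h]

theorem boundaries_le_cycles (X : SimplicialGroup.{u}) (n : ℕ) :
    X.boundaries n ≤ X.cycles n := by
  cases n with
  | zero => exact le_top
  | succ n =>
    rintro _ ⟨z, hz, rfl⟩
    simp only [SetLike.mem_coe, Subgroup.mem_iInf, MonoidHom.mem_ker] at hz
    simp only [cycles, Subgroup.mem_iInf, MonoidHom.mem_ker]
    intro j
    have h := X.d_d n (Fin.last (n + 1)) j (Fin.le_last j) z
    rw [Fin.succ_last] at h
    rw [h, hz j, map_one]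

/-- The homotopy group `πₙ(X)`, as the `n`-th homology of the Moore complex. -/
abbrev homotopyGroup (X : SimplicialGroup.{u}) (n : ℕ) : Type u :=
  X.cycles n ⧸ (X.boundaries n).subgroupOf (X.cycles n)

/-- A simplicial group is free if each `Xₙ` is a free group, with bases that can be chosen so that
the degeneracies send basis elements to basis elements. -/
def IsFree (X : SimplicialGroup.{u}) : Prop :=
  ∃ (ι : ℕ → Type u) (b : ∀ n, FreeGroupBasis (ι n) (X.obj n)),
    ∀ (n : ℕ) (i : Fin (n + 1)) (a : ι n), ∃ a' : ι (n + 1), X.s n i (b n a) = b (n + 1) a'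

/-- The simplicial group `X / V(X)`, which is `Xₙ / V(Xₙ)` in degree `n`. -/
def modVerbal (V : Set (FreeGroup ℕ)) (X : SimplicialGroup.{u}) : SimplicialGroup.{u} where
  obj n := X.obj n ⧸ verbalSubgroup V (X.obj n)
  d n i := QuotientGroup.map _ _ (X.d n i) (verbalSubgroup_le_comap V _)
  s n i := QuotientGroup.map _ _ (X.s n i) (verbalSubgroup_le_comap V _)
  d_d n i j h := by
    rintro ⟨x⟩
    exact congrArg QuotientGroup.mk (X.d_d n i j h x)
  s_s n i j h := by
    rintro ⟨x⟩
    exact congrArg QuotientGroup.mk (X.s_s n i j h x)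
  d_s_of_lt n i j h := by
    rintro ⟨x⟩
    exact congrArg QuotientGroup.mk (X.d_s_of_lt n i j h x)
  d_s_self n i := by
    rintro ⟨x⟩
    exact congrArg QuotientGroup.mk (X.d_s_self n i x)
  d_s_succ n i := by
    rintro ⟨x⟩
    exact congrArg QuotientGroup.mk (X.d_s_succ n i x)
  d_s_of_gt n i j h := by
    rintro ⟨x⟩
    exact congrArg QuotientGroup.mk (X.d_s_of_gt n i j h x)

/-- The homomorphism `α / V(α) : X / V(X) → Y / V(Y)` induced by `α : X → Y`. -/
def Hom.modVerbal (V : Set (FreeGroup ℕ)) {X Y : SimplicialGroup.{u}} (α : Hom X Y) :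
    Hom (X.modVerbal V) (Y.modVerbal V) where
  app n := QuotientGroup.map _ _ (α.app n) (verbalSubgroup_le_comap V _)
  app_d n i := by
    rintro ⟨x⟩
    exact congrArg QuotientGroup.mk (α.app_d n i x)
  app_s n i := by
    rintro ⟨x⟩
    exact congrArg QuotientGroup.mk (α.app_s n i x)

/-- The kernel of a homomorphism of simplicial groups, formed in each degree, with the restricted
faces and degeneracies. -/
def Hom.ker {X Y : SimplicialGroup.{u}} (α : Hom X Y) : SimplicialGroup.{u} where
  obj n := (α.app n).ker
  d n i := ((X.d n i).comp (α.app (n + 1)).ker.subtype).codRestrict (α.app n).ker fun x => by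
    have hx : α.app (n + 1) x = 1 := x.2
    simp [MonoidHom.mem_ker, α.app_d, hx]
  s n i := ((X.s n i).comp (α.app n).ker.subtype).codRestrict (α.app (n + 1)).ker fun x => by
    have hx : α.app n x = 1 := x.2
    simp [MonoidHom.mem_ker, α.app_s, hx]
  d_d n i j h x := Subtype.ext (X.d_d n i j h x)
  s_s n i j h x := Subtype.ext (X.s_s n i j h x)
  d_s_of_lt n i j h x := Subtype.ext (X.d_s_of_lt n i j h x)
  d_s_self n i x := Subtype.ext (X.d_s_self n i x)
  d_s_succ n i x := Subtype.ext (X.d_s_succ n i x)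
  d_s_of_gt n i j h x := Subtype.ext (X.d_s_of_gt n i j h x)

end SimplicialGroup

/-! ### Free simplicial resolutions and the Baer invariant of a pair -/

/-- A free simplicial resolution of the group `G`: a free simplicial group `X` with
`π₀(X) ≅ G` and `πₘ(X)` trivial for `m ≥ 1`. The isomorphism `π₀(X) ≅ G` is given as the
surjection `aug : X₀ → G` whose kernel is the subgroup of `0`-boundaries. -/
structure FreeSimplicialResolution (G : Type u) [Group G] where
  X : SimplicialGroup.{u}
  isFree : X.IsFree
  aug : X.obj 0 →* G
  aug_surjective : Function.Surjective aug
  ker_aug : aug.ker = X.boundaries 0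
  subsingleton_homotopyGroup : ∀ m, 1 ≤ m → Subsingleton (X.homotopyGroup m)

/-- Resolution data for a pair `(G, N)`: free simplicial resolutions `K` of `G` and `L` of `G / N`
and an epimorphism `α : K → L` of simplicial groups that induces the natural epimorphism
`G → G / N` on `π₀`. -/
structure PairResolution {G : Type u} [Group G] (N : Subgroup G) [N.Normal] where
  K : FreeSimplicialResolution G
  L : FreeSimplicialResolution (G ⧸ N)
  α : SimplicialGroup.Hom K.X L.X
  surjective : ∀ n, Function.Surjective (α.app n)
  aug_app : ∀ x : K.X.obj 0, L.aug (α.app 0 x) = QuotientGroup.mk' N (K.aug x)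

/-- The Baer invariant `𝒱M(G, N) = π₁(ker (α / V(α)))` of the pair `(G, N)` with respect to the
variety defined by the laws `V`, formed with given resolution data. -/
abbrev PairResolution.baerInvariant {G : Type u} [Group G] {N : Subgroup G} [N.Normal]
    (P : PairResolution N) (V : Set (FreeGroup ℕ)) : Type u :=
  (P.α.modVerbal V).ker.homotopyGroup 1

/-! ### Words and verbal subgroups -/

section Words

variable {X : Type u} [Group X] {Y : Type v} [Group Y] (V : Set (FreeGroup ℕ))

/-! Write `aug` for the augmentation of `K`, `R = ker aug`, `S = aug⁻¹(N)`. Two homomorphisms that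
agree modulo a normal subgroup `M` agree on verbal subgroups modulo `[M V* Y]`
(`map_mul_inv_map_mem_starSubgroup`). Hence the kernel of a split epimorphism meets `V(X)` inside
its own star subgroup. Applied to `d₀`, split by `s₀`, this gives `[R V* K₀] = d₁(V(K₁) ∩ ker d₀)`
(`mem_starSubgroup_ker_aug`), and likewise for `L`.

Every class of the Baer invariant is represented by some `x` in `K₁` with `d₀ x = 1`, `α x ∈ V(L₁)`
and `d₁ x ∈ V(K₀)`. The map `x ↦ d₁ x` sends these representatives onto `R ∩ [S V* K₀]`, and `x`
represents the trivial class exactly when `d₁ x ∈ [R V* K₀]`. That the latter condition implies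
triviality uses the complement: it yields sections of `α` in degrees 0 and 1 that commute with both
faces, so the part of a cycle seen by `L` can be removed inside `V(K₁)`; what is left is a cycle of
`ker α`, and it bounds there because `π₁(K)` and `π₂(L)` are trivial.

Lifts between the free groups `K₀` and `F` over `G` are mutually inverse modulo the kernels, so they
identify the two quotients. Resolution data exist because the free bar resolution is functorial and
preserves surjections. -/

theorem exists_lift_eq_of_forall_lt (w : FreeGroup ℕ) :
    ∃ n : ℕ, ∀ g h : ℕ → X, (∀ i < n, g i = h i) → FreeGroup.lift g w = FreeGroup.lift h w := by
  induction w using FreeGroup.induction_on with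
  | C1 => exact ⟨0, fun g h _ => by simp⟩
  | of i => exact ⟨i + 1, fun g h e => by simpa using e i (Nat.lt_succ_self i)⟩
  | inv_of i _ => exact ⟨i + 1, fun g h e => by simpa using e i (Nat.lt_succ_self i)⟩
  | mul a b ha hb =>
    obtain ⟨m, hm⟩ := ha
    obtain ⟨n, hn⟩ := hb
    refine ⟨max m n, fun g h e => ?_⟩
    rw [map_mul, map_mul, hm g h fun i hi => e i (lt_max_of_lt_left hi),
      hn g h fun i hi => e i (lt_max_of_lt_right hi)]

variable {V}

/-- The letters are exchanged one at a time, each exchange costing one generator of the star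
subgroup; only finitely many letters occur in `w`. -/
theorem lift_mul_inv_lift_mem_starSubgroup {N : Subgroup X} {w : FreeGroup ℕ} (hw : w ∈ V)
    (g h : ℕ → X) (hgh : ∀ i, (h i)⁻¹ * g i ∈ N) :
    FreeGroup.lift g w * (FreeGroup.lift h w)⁻¹ ∈ starSubgroup V N := by
  obtain ⟨n, hn⟩ := exists_lift_eq_of_forall_lt (X := X) w
  have key : ∀ m : ℕ, FreeGroup.lift (fun i => if i < m then g i else h i) w *
      (FreeGroup.lift h w)⁻¹ ∈ starSubgroup V N := by
    intro m
    induction m with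
    | zero => simp [one_mem]
    | succ m ih =>
      have hupd : (fun i => if i < m + 1 then g i else h i) =
          Function.update (fun i => if i < m then g i else h i) m
            ((fun i => if i < m then g i else h i) m * ((h m)⁻¹ * g m)) := by
        funext i
        rcases eq_or_ne i m with rfl | hi
        · simp
        · rw [Function.update_of_ne hi]
          have : i < m + 1 ↔ i < m := by omega
          simp only [this]
      have hgen : FreeGroup.lift (fun i => if i < m + 1 then g i else h i) w *
          (FreeGroup.lift (fun i => if i < m then g i else h i) w)⁻¹ ∈ starSubgroup V N := by
        rw [hupd]
        exact Subgroup.subset_closure ⟨w, hw, _, m, _, hgh m, rfl⟩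
      simpa [mul_assoc] using mul_mem hgen ih
  have := key n
  rwa [hn (fun i => if i < n then g i else h i) g fun i hi => if_pos hi] at this

/-- Two homomorphisms that agree modulo `N` agree modulo `[N V* Y]` on the verbal subgroup. -/
theorem map_mul_inv_map_mem_starSubgroup {N : Subgroup Y} [N.Normal] (f g : X →* Y)
    (hfg : ∀ x, (g x)⁻¹ * f x ∈ N) {x : X} (hx : x ∈ verbalSubgroup V X) :
    f x * (g x)⁻¹ ∈ starSubgroup V N := by
  have key : verbalSubgroup V X ≤ ((QuotientGroup.mk' (starSubgroup V N)).comp f).eqLocus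
      ((QuotientGroup.mk' (starSubgroup V N)).comp g) := by
    refine (Subgroup.closure_le _).2 ?_
    rintro _ ⟨w, hw, a, rfl⟩
    change (QuotientGroup.mk (f _) : Y ⧸ starSubgroup V N) = QuotientGroup.mk (g _)
    rw [QuotientGroup.eq_iff_div_mem, map_lift_word, map_lift_word, div_eq_mul_inv]
    exact lift_mul_inv_lift_mem_starSubgroup hw _ _ fun i => hfg (a i)
  have h : (QuotientGroup.mk (f x) : Y ⧸ starSubgroup V N) = QuotientGroup.mk (g x) := key hx
  rwa [QuotientGroup.eq_iff_div_mem, div_eq_mul_inv] at h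

theorem starSubgroup_le_verbalSubgroup (N : Subgroup X) :
    starSubgroup V N ≤ verbalSubgroup V X := by
  refine (Subgroup.closure_le _).2 ?_
  rintro _ ⟨w, hw, g, i, n, -, rfl⟩
  exact mul_mem (Subgroup.subset_closure ⟨w, hw, _, rfl⟩)
    (inv_mem (Subgroup.subset_closure ⟨w, hw, _, rfl⟩))

theorem starSubgroup_mono {M N : Subgroup X} (h : M ≤ N) : starSubgroup V M ≤ starSubgroup V N := by
  refine Subgroup.closure_mono ?_
  rintro _ ⟨w, hw, g, i, n, hn, rfl⟩
  exact ⟨w, hw, g, i, n, h hn, rfl⟩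

theorem map_update_mul (f : X →* Y) (g : ℕ → X) (i : ℕ) (n : X) :
    (fun j => f (Function.update g i (g i * n) j)) =
      Function.update (fun j => f (g j)) i (f (g i) * f n) := by
  funext j
  rcases eq_or_ne j i with rfl | hj
  · simp
  · simp [Function.update_of_ne hj]

theorem starSubgroup_le_comap (f : X →* Y) {M : Subgroup X} {N : Subgroup Y}
    (h : M ≤ N.comap f) : starSubgroup V M ≤ (starSubgroup V N).comap f := by
  refine (Subgroup.closure_le _).2 ?_
  rintro _ ⟨w, hw, g, i, n, hn, rfl⟩
  refine Subgroup.subset_closure ⟨w, hw, fun j => f (g j), i, f n, h hn, ?_⟩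
  rw [map_mul, map_inv, map_lift_word, map_lift_word, map_update_mul]

theorem starSubgroup_le_map (f : X →* Y) (hf : Function.Surjective f) {M : Subgroup X}
    {N : Subgroup Y} (h : N ≤ M.map f) : starSubgroup V N ≤ (starSubgroup V M).map f := by
  refine (Subgroup.closure_le _).2 ?_
  rintro _ ⟨w, hw, g, i, n, hn, rfl⟩
  obtain ⟨m, hm, rfl⟩ := h hn
  refine ⟨_, Subgroup.subset_closure
    ⟨w, hw, fun j => Function.surjInv hf (g j), i, m, hm, rfl⟩, ?_⟩
  rw [map_mul, map_inv, map_lift_word, map_lift_word, map_update_mul]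
  simp only [Function.surjInv_eq hf]

theorem starSubgroup_ker_le (f : X →* Y) : starSubgroup V f.ker ≤ f.ker := by
  refine (Subgroup.closure_le _).2 ?_
  rintro _ ⟨w, hw, g, i, n, hn, rfl⟩
  have hn' : f n = 1 := hn
  rw [SetLike.mem_coe, MonoidHom.mem_ker, map_mul, map_inv, map_lift_word, map_lift_word,
    map_update_mul, hn', mul_one, Function.update_eq_self, mul_inv_cancel]

/-- If the surjection `f` splits, then `ker f ∩ V(X)` is contained in `[ker f V* X]`. -/
theorem ker_inf_verbalSubgroup_le (f : X →* Y) (g : Y →* X) (hfg : ∀ y, f (g y) = y) :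
    f.ker ⊓ verbalSubgroup V X ≤ starSubgroup V f.ker := by
  rintro x ⟨hx, hxV⟩
  -- The identity is compared with the idempotent `g ∘ f`, which is trivial on `ker f`.
  have h := map_mul_inv_map_mem_starSubgroup (N := f.ker) (MonoidHom.id X) (g.comp f)
    (fun x => by simp [MonoidHom.mem_ker, hfg]) hxV
  have hx' : f x = 1 := hx
  simpa [hx'] using h

end Words

/-- A homomorphism out of a free group can be prescribed by a relation that every element of a
basis satisfies with some element. -/
theorem FreeGroupBasis.exists_hom {ι : Type*} {X : Type*} [Group X] {Y : Type*} [Group Y]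
    (b : FreeGroupBasis ι X) {r : ι → Y → Prop} (h : ∀ i, ∃ y, r i y) :
    ∃ f : X →* Y, ∀ i, r i (f (b i)) := by
  choose y hy using h
  exact ⟨b.lift y, fun i => by simpa using hy i⟩

/-! ### The free bar resolution -/

/-- The iterated free groups `G`, `FreeGroup G`, `FreeGroup (FreeGroup G)`, … -/
def freeTower (G : Type u) [Group G] : ℕ → GrpCat.{u}
  | 0 => GrpCat.of G
  | n + 1 => GrpCat.of (FreeGroup (freeTower G n))

namespace freeTower

variable {G : Type u} [Group G] {H : Type u} [Group H]

/-- The generators of the free group `freeTower G (n + 1)`. -/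
def gen {n : ℕ} (x : freeTower G n) : freeTower G (n + 1) := FreeGroup.of x

/-- Extension of a map on generators to a homomorphism. -/
def lift {n : ℕ} {Y : Type v} [Group Y] (f : freeTower G n → Y) : freeTower G (n + 1) →* Y :=
  FreeGroup.lift f

@[simp] theorem lift_gen {n : ℕ} {Y : Type v} [Group Y] (f : freeTower G n → Y)
    (x : freeTower G n) : lift f (gen x) = f x :=
  FreeGroup.lift_apply_of

theorem hom_ext {n : ℕ} {Y : Type v} [Group Y] {f g : freeTower G (n + 1) →* Y}
    (h : ∀ x : freeTower G n, f (gen x) = g (gen x)) : f = g :=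
  FreeGroup.ext_hom (α := freeTower G n) f g h

/-- The faces of the bar resolution, including the augmentation. -/
def face : ∀ n : ℕ, Fin (n + 1) → (freeTower G (n + 1) →* freeTower G n)
  | 0 => fun _ => lift id
  -- Evaluation of the outermost free group is the last face; the other faces come from the previous
  -- stage by functoriality.
  | n + 1 => Fin.lastCases (lift id) fun i => lift fun x => gen (face n i x)

/-- The degeneracies of the bar resolution. -/
def degen : ∀ n : ℕ, Fin n → (freeTower G n →* freeTower G (n + 1))
  | 0 => fun i => i.elim0
  | n + 1 => Fin.lastCases (lift fun x => gen (gen x)) fun i => lift fun x => gen (degen n i x)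

@[simp] theorem face_last (n : ℕ) (x : freeTower G n) : face n (Fin.last n) (gen x) = x := by
  cases n <;> simp [face]

@[simp] theorem face_castSucc (n : ℕ) (i : Fin (n + 1)) (x : freeTower G (n + 1)) :
    face (n + 1) i.castSucc (gen x) = gen (face n i x) := by
  simp [face]

@[simp] theorem degen_last (n : ℕ) (x : freeTower G n) :
    degen (n + 1) (Fin.last n) (gen x) = gen (gen x) := by
  simp [degen]

@[simp] theorem degen_castSucc (n : ℕ) (i : Fin n) (x : freeTower G n) :
    degen (n + 1) i.castSucc (gen x) = gen (degen n i x) := by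
  simp [degen]

/-- As for the other simplicial identities below, it suffices to look at generators: cases with a
last index follow from the evaluation rules, and the others are `gen` applied to the identity one
stage down. -/
theorem face_face (n : ℕ) : ∀ i j : Fin (n + 1), j ≤ i → ∀ x : freeTower G (n + 2),
    face n j (face (n + 1) i.succ x) = face n i (face (n + 1) j.castSucc x) := by
  induction n with
  | zero =>
    intro i j _ x
    refine DFunLike.congr_fun (f := (face 0 j).comp (face 1 i.succ))
      (g := (face 0 i).comp (face 1 j.castSucc)) (hom_ext fun x => ?_) x
    obtain rfl : i = Fin.last 0 := Fin.ext (by omega)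
    change face 0 j (face 1 (Fin.last 0).succ (gen x)) =
      face 0 (Fin.last 0) (face 1 j.castSucc (gen x))
    rw [Fin.succ_last, face_last, face_castSucc, face_last]
  | succ n ih =>
    intro i j hij x
    refine DFunLike.congr_fun (f := (face (n + 1) j).comp (face (n + 2) i.succ))
      (g := (face (n + 1) i).comp (face (n + 2) j.castSucc)) (hom_ext fun x => ?_) x
    induction i using Fin.lastCases with
    | last => simp
    | cast i =>
      induction j using Fin.lastCases with
      | last => exact absurd hij (not_le.2 i.castSucc_lt_last)
      | cast j => simp [← Fin.castSucc_succ, ih i j (by simpa using hij)]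

theorem degen_degen (n : ℕ) : ∀ i j : Fin n, j ≤ i → ∀ x : freeTower G n,
    degen (n + 1) j.castSucc (degen n i x) = degen (n + 1) i.succ (degen n j x) := by
  induction n with
  | zero => exact fun i => i.elim0
  | succ n ih =>
    intro i j hij x
    refine DFunLike.congr_fun (f := (degen (n + 2) j.castSucc).comp (degen (n + 1) i))
      (g := (degen (n + 2) i.succ).comp (degen (n + 1) j)) (hom_ext fun x => ?_) x
    induction i using Fin.lastCases with
    | last =>
      induction j using Fin.lastCases with
      | last => simp
      | cast j => simp
    | cast i =>
      induction j using Fin.lastCases with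
      | last => exact absurd hij (not_le.2 i.castSucc_lt_last)
      | cast j => simp [← Fin.castSucc_succ, ih i j (by simpa using hij)]

theorem face_degen_self (n : ℕ) : ∀ (i : Fin n) (x : freeTower G n),
    face n i.castSucc (degen n i x) = x := by
  induction n with
  | zero => exact fun i => i.elim0
  | succ n ih =>
    intro i x
    refine DFunLike.congr_fun (f := (face (n + 1) i.castSucc).comp (degen (n + 1) i))
      (g := MonoidHom.id _) (hom_ext fun x => ?_) x
    induction i using Fin.lastCases with
    | last => simp
    | cast i => simp [ih]

theorem face_degen_succ (n : ℕ) : ∀ (i : Fin n) (x : freeTower G n),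
    face n i.succ (degen n i x) = x := by
  induction n with
  | zero => exact fun i => i.elim0
  | succ n ih =>
    intro i x
    refine DFunLike.congr_fun (f := (face (n + 1) i.succ).comp (degen (n + 1) i))
      (g := MonoidHom.id _) (hom_ext fun x => ?_) x
    induction i using Fin.lastCases with
    | last => simp
    | cast i => simp [← Fin.castSucc_succ, ih]

theorem face_degen_of_lt (n : ℕ) : ∀ (i : Fin n) (j : Fin (n + 1)), j ≤ i.castSucc →
    ∀ x : freeTower G (n + 1),
    face (n + 1) j.castSucc (degen (n + 1) i.succ x) = degen n i (face n j x) := by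
  induction n with
  | zero => exact fun i => i.elim0
  | succ n ih =>
    intro i j hij x
    refine DFunLike.congr_fun (f := (face (n + 2) j.castSucc).comp (degen (n + 2) i.succ))
      (g := (degen (n + 1) i).comp (face (n + 1) j)) (hom_ext fun x => ?_) x
    induction j using Fin.lastCases with
    | last => exact absurd hij (not_le.2 i.castSucc_lt_last)
    | cast j =>
      induction i using Fin.lastCases with
      | last => simp
      | cast i => simp [← Fin.castSucc_succ, ih i j (by simpa using hij)]

theorem face_degen_of_gt (n : ℕ) : ∀ (i : Fin n) (j : Fin (n + 1)), i.castSucc < j →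
    ∀ x : freeTower G (n + 1),
    face (n + 1) j.succ (degen (n + 1) i.castSucc x) = degen n i (face n j x) := by
  induction n with
  | zero => exact fun i => i.elim0
  | succ n ih =>
    intro i j hij x
    refine DFunLike.congr_fun (f := (face (n + 2) j.succ).comp (degen (n + 2) i.castSucc))
      (g := (degen (n + 1) i).comp (face (n + 1) j)) (hom_ext fun x => ?_) x
    induction j using Fin.lastCases with
    | last => simp
    | cast j =>
      induction i using Fin.lastCases with
      | last => exact absurd hij (not_lt.2 (by simpa using j.le_last))
      | cast i => simp [← Fin.castSucc_succ, ih i j (by simpa using hij)]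

/-- The simplicial group of the bar resolution. -/
def simplicialGroup (G : Type u) [Group G] : SimplicialGroup.{u} where
  obj n := freeTower G (n + 1)
  d n := face (n + 1)
  s n := degen (n + 1)
  d_d n := face_face (n + 1)
  s_s n := degen_degen (n + 1)
  d_s_of_lt n := face_degen_of_lt (n + 1)
  d_s_self n := face_degen_self (n + 1)
  d_s_succ n := face_degen_succ (n + 1)
  d_s_of_gt n := face_degen_of_gt (n + 1)

theorem isFree_simplicialGroup (G : Type u) [Group G] : (simplicialGroup G).IsFree := by
  refine ⟨fun n => freeTower G n, fun n => FreeGroupBasis.ofFreeGroup _, fun n i a => ?_⟩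
  change ∃ a' : freeTower G (n + 1), degen (n + 1) i (gen a) = gen a'
  induction i using Fin.lastCases with
  | last => exact ⟨_, degen_last n a⟩
  | cast i => exact ⟨_, degen_castSucc n i a⟩

/-- The element `gen x * (gen 1)⁻¹` bounds `x` if all faces of `x` are trivial. -/
theorem exists_face_last_eq (n : ℕ) (x : freeTower G (n + 1)) (hx : ∀ i, face n i x = 1) :
    ∃ y : freeTower G (n + 2), (∀ i : Fin (n + 1), face (n + 1) i.castSucc y = 1) ∧
      face (n + 1) (Fin.last (n + 1)) y = x := by
  -- The map `gen` is a contraction of sets only: the lower faces send `gen x` to `gen 1`, not to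
  -- `1`, hence the correcting factor, which the last face kills.
  refine ⟨gen x * (gen 1)⁻¹, fun i => ?_, ?_⟩
  · simp [hx i]
  · simp

/-- The bar resolution as a free simplicial resolution. -/
def resolution (G : Type u) [Group G] : FreeSimplicialResolution G where
  X := simplicialGroup G
  isFree := isFree_simplicialGroup G
  aug := face (G := G) 0 0
  aug_surjective x := ⟨gen (G := G) (n := 0) x, face_last (G := G) 0 x⟩
  ker_aug := by
    ext x
    constructor
    · intro hx
      obtain ⟨y, hy, rfl⟩ := exists_face_last_eq 0 x fun i => by
        obtain rfl : i = 0 := Fin.ext (by omega)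
        exact hx
      exact ⟨y, Subgroup.mem_iInf.2 hy, rfl⟩
    · rintro ⟨y, hy, rfl⟩
      have h : face 1 (Fin.castSucc 0) y = 1 := Subgroup.mem_iInf.1 hy 0
      have h' := face_face (G := G) 0 0 0 le_rfl y
      rw [h, map_one] at h'
      exact h'
  subsingleton_homotopyGroup m hm := by
    obtain ⟨m, rfl⟩ := Nat.exists_eq_add_of_le' hm
    refine QuotientGroup.subsingleton_iff.2 (Subgroup.subgroupOf_eq_top.2 fun x hx => ?_)
    obtain ⟨y, hy, rfl⟩ := exists_face_last_eq (m + 1) x (Subgroup.mem_iInf.1 hx)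
    exact ⟨y, Subgroup.mem_iInf.2 hy, rfl⟩

/-- Functoriality of the iterated free groups. -/
def map (f : G →* H) : ∀ n : ℕ, freeTower G n →* freeTower H n
  | 0 => f
  | n + 1 => lift fun x => gen (map f n x)

@[simp] theorem map_gen (f : G →* H) (n : ℕ) (x : freeTower G n) :
    map f (n + 1) (gen x) = gen (map f n x) := by
  simp [map]

theorem map_face (f : G →* H) (n : ℕ) : ∀ (i : Fin (n + 1)) (x : freeTower G (n + 1)),
    map f n (face n i x) = face n i (map f (n + 1) x) := by
  induction n with
  | zero =>
    intro i x
    refine DFunLike.congr_fun (f := (map f 0).comp (face 0 i))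
      (g := (face 0 i).comp (map f 1)) (hom_ext fun x => ?_) x
    obtain rfl : i = Fin.last 0 := Fin.ext (by omega)
    change map f 0 (face 0 (Fin.last 0) (gen x)) = face 0 (Fin.last 0) (map f 1 (gen x))
    rw [map_gen, face_last, face_last]
  | succ n ih =>
    intro i x
    refine DFunLike.congr_fun (f := (map f (n + 1)).comp (face (n + 1) i))
      (g := (face (n + 1) i).comp (map f (n + 2))) (hom_ext fun x => ?_) x
    induction i using Fin.lastCases with
    | last => simp
    | cast i => simp [ih]

theorem map_degen (f : G →* H) (n : ℕ) : ∀ (i : Fin n) (x : freeTower G n),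
    map f (n + 1) (degen n i x) = degen n i (map f n x) := by
  induction n with
  | zero => exact fun i => i.elim0
  | succ n ih =>
    intro i x
    refine DFunLike.congr_fun (f := (map f (n + 2)).comp (degen (n + 1) i))
      (g := (degen (n + 1) i).comp (map f (n + 1))) (hom_ext fun x => ?_) x
    induction i using Fin.lastCases with
    | last => simp
    | cast i => simp [ih]

theorem map_surjective (f : G →* H) (hf : Function.Surjective f) (n : ℕ) :
    Function.Surjective (map f n) := by
  induction n with
  | zero => exact hf
  | succ n ih =>
    have h : map f (n + 1) = FreeGroup.map (map f n) :=
      hom_ext fun x => (map_gen f n x).trans FreeGroup.map.of.symm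
    rw [h]
    exact FreeGroup.map_surjective ih

/-- The bar resolutions of `G` and `G / N` as resolution data of the pair `(G, N)`. -/
def pairResolution (N : Subgroup G) [N.Normal] : PairResolution N where
  K := resolution G
  L := resolution (G ⧸ N)
  α :=
    { app := fun n => map (QuotientGroup.mk' N) (n + 1)
      app_d := fun n => map_face (QuotientGroup.mk' N) (n + 1)
      app_s := fun n => map_degen (QuotientGroup.mk' N) (n + 1) }
  surjective n := map_surjective _ (QuotientGroup.mk'_surjective N) (n + 1)
  aug_app x := (map_face (QuotientGroup.mk' N) 0 0 x).symm

end freeTower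

/-! ### Moore complexes of resolutions -/

namespace SimplicialGroup

variable {X Y : SimplicialGroup.{u}}

theorem mem_boundaries_zero {x : X.obj 0} :
    x ∈ X.boundaries 0 ↔ ∃ y : X.obj 1, X.d 0 0 y = 1 ∧ X.d 0 1 y = x := by
  constructor
  · rintro ⟨y, hy, rfl⟩
    exact ⟨y, Subgroup.mem_iInf.1 hy 0, rfl⟩
  · rintro ⟨y, hy, rfl⟩
    refine ⟨y, Subgroup.mem_iInf.2 fun i => ?_, rfl⟩
    obtain rfl : i = 0 := Fin.ext (by omega)
    exact hy

theorem mem_boundaries_one {x : X.obj 1} :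
    x ∈ X.boundaries 1 ↔ ∃ y : X.obj 2, X.d 1 0 y = 1 ∧ X.d 1 1 y = 1 ∧ X.d 1 2 y = x := by
  constructor
  · rintro ⟨y, hy, rfl⟩
    exact ⟨y, Subgroup.mem_iInf.1 hy 0, Subgroup.mem_iInf.1 hy 1, rfl⟩
  · rintro ⟨y, h0, h1, rfl⟩
    refine ⟨y, Subgroup.mem_iInf.2 fun i => ?_, rfl⟩
    fin_cases i
    exacts [h0, h1]

theorem mem_cycles_one {x : X.obj 1} :
    x ∈ X.cycles 1 ↔ X.d 0 0 x = 1 ∧ X.d 0 1 x = 1 := by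
  constructor
  · intro h
    exact ⟨Subgroup.mem_iInf.1 h 0, Subgroup.mem_iInf.1 h 1⟩
  · rintro ⟨h0, h1⟩
    refine Subgroup.mem_iInf.2 fun i => ?_
    fin_cases i
    exacts [h0, h1]

/-- A surjection of simplicial groups is surjective on Moore complexes. -/
theorem Hom.exists_lift (α : Hom X Y) (hα : ∀ n, Function.Surjective (α.app n)) (n : ℕ)
    (e : Y.obj (n + 1)) (he : ∀ i : Fin (n + 1), Y.d n i.castSucc e = 1) :
    ∃ k, α.app (n + 1) k = e ∧ ∀ i : Fin (n + 1), X.d n i.castSucc k = 1 := by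
  -- The faces of a lift `k` are killed in increasing order. Dividing by `s_a d_a k` kills face `a`,
  -- leaves the image unchanged since `d_a e = 1`, and keeps the earlier faces trivial since `d_i
  -- s_a d_a k = s_{a-1} d_{a-1} d_i k` for `i < a`.
  have key : ∀ m : ℕ, m ≤ n + 1 →
      ∃ k, α.app (n + 1) k = e ∧ ∀ i : Fin (n + 1), (i : ℕ) < m → X.d n i.castSucc k = 1 := by
    intro m
    induction m with
    | zero =>
      intro _
      obtain ⟨k, hk⟩ := hα (n + 1) e
      exact ⟨k, hk, fun i hi => absurd hi (Nat.not_lt_zero _)⟩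
    | succ m ih =>
      intro hm
      obtain ⟨k, hk, hd⟩ := ih (by omega)
      let a : Fin (n + 1) := ⟨m, hm⟩
      refine ⟨k * (X.s n a (X.d n a.castSucc k))⁻¹, ?_, fun i hi => ?_⟩
      · rw [map_mul, map_inv, α.app_s, α.app_d, hk, he, map_one, inv_one, mul_one]
      · rcases eq_or_ne i a with rfl | hia
        · simp [X.d_s_self]
        · have hia' : (i : ℕ) ≠ m := fun h => hia (Fin.ext h)
          have hlt : (i : ℕ) < m := by omega
          rw [map_mul, map_inv, hd i hlt, one_mul, inv_eq_one]
          cases n with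
          | zero => omega
          | succ n =>
            have ha : a = Fin.succ ⟨m - 1, by omega⟩ := Fin.ext (by simp [a]; omega)
            have hij : i ≤ Fin.castSucc ⟨m - 1, by omega⟩ := by
              rw [Fin.le_def]
              simp
              omega
            have hd' := X.d_d n ⟨m - 1, by omega⟩ ⟨i, by omega⟩ (by rw [Fin.le_def]; simp; omega) k
            rw [ha, X.d_s_of_lt n _ i hij]
            have : X.d n i (X.d (n + 1) (Fin.castSucc (Fin.succ ⟨m - 1, by omega⟩)) k) = 1 := by
              refine hd'.trans ?_
              rw [show Fin.castSucc (⟨i, by omega⟩ : Fin (n + 2)) = i.castSucc from rfl,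
                hd i hlt, map_one]
            rw [this, map_one]
  obtain ⟨k, hk, hd⟩ := key (n + 1) le_rfl
  exact ⟨k, hk, fun i => hd i i.2⟩

end SimplicialGroup

namespace FreeSimplicialResolution

variable {G : Type u} [Group G] (K : FreeSimplicialResolution G)

theorem exists_of_aug_eq_one {x : K.X.obj 0} (hx : K.aug x = 1) :
    ∃ y : K.X.obj 1, K.X.d 0 0 y = 1 ∧ K.X.d 0 1 y = x := by
  have h : x ∈ K.aug.ker := hx
  rwa [K.ker_aug, SimplicialGroup.mem_boundaries_zero] at h

theorem aug_d_one {y : K.X.obj 1} (hy : K.X.d 0 0 y = 1) : K.aug (K.X.d 0 1 y) = 1 := by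
  have h : K.X.d 0 1 y ∈ K.X.boundaries 0 := SimplicialGroup.mem_boundaries_zero.2 ⟨y, hy, rfl⟩
  rwa [← K.ker_aug] at h

theorem d_zero_s (x : K.X.obj 0) : K.X.d 0 0 (K.X.s 0 0 x) = x := K.X.d_s_self 0 0 x

theorem d_one_s (x : K.X.obj 0) : K.X.d 0 1 (K.X.s 0 0 x) = x := K.X.d_s_succ 0 0 x

theorem aug_d_eq (y : K.X.obj 1) : K.aug (K.X.d 0 1 y) = K.aug (K.X.d 0 0 y) := by
  have h := K.aug_d_one (y := y * (K.X.s 0 0 (K.X.d 0 0 y))⁻¹)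
    (by rw [map_mul, map_inv, d_zero_s, mul_inv_cancel])
  rwa [map_mul, map_inv, d_one_s, map_mul, map_inv, mul_inv_eq_one] at h

theorem exists_of_cycle (n : ℕ) {x : K.X.obj (n + 1)} (hx : ∀ i, K.X.d n i x = 1) :
    ∃ y : K.X.obj (n + 2), (∀ i : Fin (n + 2), K.X.d (n + 1) i.castSucc y = 1) ∧
      K.X.d (n + 1) (Fin.last (n + 2)) y = x := by
  have h := Subgroup.subgroupOf_eq_top.1 (QuotientGroup.subsingleton_iff.1
    (K.subsingleton_homotopyGroup (n + 1) (by omega))) (Subgroup.mem_iInf.2 hx)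
  obtain ⟨y, hy, rfl⟩ := h
  exact ⟨y, Subgroup.mem_iInf.1 hy, rfl⟩

theorem exists_of_cycle_one {x : K.X.obj 1} (h0 : K.X.d 0 0 x = 1) (h1 : K.X.d 0 1 x = 1) :
    ∃ y : K.X.obj 2, K.X.d 1 0 y = 1 ∧ K.X.d 1 1 y = 1 ∧ K.X.d 1 2 y = x := by
  obtain ⟨y, hy, hyx⟩ := K.exists_of_cycle 0 (x := x) fun i => by
    fin_cases i
    exacts [h0, h1]
  exact ⟨y, hy 0, hy 1, hyx⟩

theorem d_one_surjective : Function.Surjective (K.X.d 0 1) := fun x => ⟨_, K.d_one_s x⟩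

/-- The subgroup `[ker aug V* K₀]` consists of the boundaries of `V(K)`. -/
theorem mem_starSubgroup_ker_aug {V : Set (FreeGroup ℕ)} {x : K.X.obj 0} :
    x ∈ starSubgroup V K.aug.ker ↔
      ∃ z ∈ verbalSubgroup V (K.X.obj 1), K.X.d 0 0 z = 1 ∧ K.X.d 0 1 z = x := by
  constructor
  · intro hx
    -- The face `d₁` is onto and carries `ker d₀` onto `ker aug`.
    obtain ⟨z, hz, rfl⟩ := starSubgroup_le_map (V := V) (K.X.d 0 1) K.d_one_surjective
      (M := (K.X.d 0 0).ker) (N := K.aug.ker) (fun a ha => by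
        obtain ⟨y, h0, h1⟩ := K.exists_of_aug_eq_one ha
        exact ⟨y, h0, h1⟩) hx
    exact ⟨z, starSubgroup_le_verbalSubgroup _ hz, starSubgroup_ker_le _ hz, rfl⟩
  · rintro ⟨z, hz, h0, rfl⟩
    exact starSubgroup_le_comap (N := K.aug.ker) (K.X.d 0 1) (fun a ha => K.aug_d_one ha)
      (ker_inf_verbalSubgroup_le (K.X.d 0 0) (K.X.s 0 0) K.d_zero_s ⟨h0, hz⟩)

end FreeSimplicialResolution

/-! ### The kernel of an epimorphism of resolutions -/

/-- Used with `A` the group of relative cycles, which maps onto both sides of the desired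
isomorphism. -/
theorem MonoidHom.nonempty_mulEquiv_of_ker_eq {A B C : Type*} [Group A] [Group B] [Group C]
    (f : A →* B) (g : A →* C) (hf : Function.Surjective f) (hg : Function.Surjective g)
    (h : f.ker = g.ker) : Nonempty (B ≃* C) :=
  ⟨(QuotientGroup.quotientKerEquivOfSurjective f hf).symm.trans
    ((QuotientGroup.quotientMulEquivOfEq h).trans
      (QuotientGroup.quotientKerEquivOfSurjective g hg))⟩

theorem Subgroup.IsComplement'.exists_section {G : Type*} [Group G] {N Q : Subgroup G} [N.Normal]
    (h : N.IsComplement' Q) :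
    ∃ σ : G ⧸ N →* G, ∀ x, QuotientGroup.mk' N (σ x) = x := by
  refine ⟨Q.subtype.comp h.symm.QuotientMulEquiv.toMonoidHom, fun x => ?_⟩
  exact h.symm.QuotientMulEquiv.symm_apply_apply x

namespace PairResolution

variable {G : Type u} [Group G] {N : Subgroup G} [N.Normal] (P : PairResolution N)

/-- Exactness at `π₀(K)` for the fibration `ker α → K → L`: a lift of `n` has a boundary as image in
`L₀`, and that boundary lifts to one in `K₀`. -/
theorem exists_ker_aug_eq {n : G} (hn : n ∈ N) :
    ∃ m, P.α.app 0 m = 1 ∧ P.K.aug m = n := by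
  obtain ⟨k, rfl⟩ := P.K.aug_surjective n
  obtain ⟨y, h0, h1⟩ := P.L.exists_of_aug_eq_one (x := P.α.app 0 k)
    (by rw [P.aug_app]; exact (QuotientGroup.eq_one_iff _).2 hn)
  obtain ⟨y', hy', hd⟩ := P.α.exists_lift P.surjective 0 y fun i => by
    obtain rfl : i = 0 := Fin.ext (by omega)
    exact h0
  refine ⟨k * (P.K.X.d 0 1 y')⁻¹, ?_, ?_⟩
  · rw [map_mul, map_inv, P.α.app_d, hy', h1, mul_inv_cancel]
  · rw [map_mul, map_inv, P.K.aug_d_one (hd 0), inv_one, mul_one]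

theorem exists_lift_one {e : P.L.X.obj 2} (h0 : P.L.X.d 1 0 e = 1) (h1 : P.L.X.d 1 1 e = 1) :
    ∃ k, P.α.app 2 k = e ∧ P.K.X.d 1 0 k = 1 ∧ P.K.X.d 1 1 k = 1 := by
  obtain ⟨k, hk, hd⟩ := P.α.exists_lift P.surjective 1 e fun i => by
    fin_cases i
    exacts [h0, h1]
  exact ⟨k, hk, hd 0, hd 1⟩

theorem K_d_zero_d_two {k : P.K.X.obj 2} (h0 : P.K.X.d 1 0 k = 1) :
    P.K.X.d 0 0 (P.K.X.d 1 2 k) = 1 := by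
  have h := P.K.X.d_d 0 1 0 (by decide) k
  refine h.trans ?_
  erw [h0]
  exact map_one _

theorem K_d_one_d_two {k : P.K.X.obj 2} (h1 : P.K.X.d 1 1 k = 1) :
    P.K.X.d 0 1 (P.K.X.d 1 2 k) = 1 := by
  have h := P.K.X.d_d 0 1 1 (by decide) k
  refine h.trans ?_
  erw [h1]
  exact map_one _

/-- Injectivity of `π₀(ker α) → π₀(K)`, which rests on `π₁(L) = 1`. -/
theorem exists_ker_boundary_zero {x : P.K.X.obj 0} (hα : P.α.app 0 x = 1) (hx : P.K.aug x = 1) :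
    ∃ m, P.α.app 1 m = 1 ∧ P.K.X.d 0 0 m = 1 ∧ P.K.X.d 0 1 m = x := by
  obtain ⟨y, h0, rfl⟩ := P.K.exists_of_aug_eq_one hx
  obtain ⟨u, hu0, hu1, hu2⟩ := P.L.exists_of_cycle_one (x := P.α.app 1 y)
    (by rw [← P.α.app_d, h0, map_one]) (by rw [← P.α.app_d, hα])
  obtain ⟨k, rfl, hk0, hk1⟩ := P.exists_lift_one hu0 hu1
  refine ⟨y * (P.K.X.d 1 2 k)⁻¹, ?_, ?_, ?_⟩
  · rw [map_mul, map_inv, P.α.app_d, hu2, mul_inv_cancel]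
  · rw [map_mul, map_inv, h0, P.K_d_zero_d_two hk0, inv_one, mul_one]
  · rw [map_mul, map_inv, P.K_d_one_d_two hk1, inv_one, mul_one]

/-- This is `π₁(ker α) = 1`. A bounding element `y` in `K₂` exists since `π₁(K) = 1`; its image is a
2-cycle of `L`, which bounds since `π₂(L) = 1`, and lifting that bound corrects `y`. -/
theorem exists_ker_boundary_one {q : P.K.X.obj 1} (hα : P.α.app 1 q = 1)
    (h0 : P.K.X.d 0 0 q = 1) (h1 : P.K.X.d 0 1 q = 1) :
    ∃ u, P.α.app 2 u = 1 ∧ P.K.X.d 1 0 u = 1 ∧ P.K.X.d 1 1 u = 1 ∧ P.K.X.d 1 2 u = q := by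
  obtain ⟨y, hy0, hy1, rfl⟩ := P.K.exists_of_cycle_one h0 h1
  obtain ⟨u, hu, hu3⟩ := P.L.exists_of_cycle 1 (x := P.α.app 2 y) fun i => by
    rw [← P.α.app_d]
    fin_cases i
    exacts [(congrArg _ hy0).trans (map_one _), (congrArg _ hy1).trans (map_one _),
      (P.α.app_d 1 2 y).trans ((P.α.app_d 1 2 y).symm.trans hα)]
  obtain ⟨k, rfl, hk⟩ := P.α.exists_lift P.surjective 2 u hu
  have hd : ∀ i : Fin 3, P.K.X.d 1 i (P.K.X.d 2 (Fin.last 3) k) = 1 := fun i => by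
    have h := P.K.X.d_d 1 (Fin.last 2) i (Fin.le_last i) k
    rw [Fin.succ_last] at h
    rw [h, hk i, map_one]
  refine ⟨y * (P.K.X.d 2 (Fin.last 3) k)⁻¹, ?_, ?_, ?_, ?_⟩
  · rw [map_mul, map_inv, P.α.app_d, hu3, mul_inv_cancel]
  · rw [map_mul, map_inv, hy0, hd, inv_one, mul_one]
  · rw [map_mul, map_inv, hy1, hd, inv_one, mul_one]
  · rw [map_mul, map_inv, hd, inv_one, mul_one]

/-! ### Face-compatible sections in degrees zero and one -/

/-- A section of `α₀` over a splitting of `G → G / N`. -/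
theorem exists_section_zero (σ : G ⧸ N →* G) (hσ : ∀ x, QuotientGroup.mk' N (σ x) = x) :
    ∃ β : P.L.X.obj 0 →* P.K.X.obj 0, (∀ x, P.α.app 0 (β x) = x) ∧
      ∀ x, P.K.aug (β x) = σ (P.L.aug x) := by
  obtain ⟨ι, b, -⟩ := P.L.isFree
  obtain ⟨β, hβ⟩ := (b 0).exists_hom
    (r := fun i y => P.α.app 0 y = b 0 i ∧ P.K.aug y = σ (P.L.aug (b 0 i))) fun i => by
      obtain ⟨k, hk⟩ := P.surjective 0 (b 0 i)
      -- An arbitrary lift `k` has the right augmentation up to an element of `N`, which `ker α₀`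
      -- can supply.
      obtain ⟨m, hm, hmk⟩ := P.exists_ker_aug_eq
        (n := (P.K.aug k)⁻¹ * σ (P.L.aug (b 0 i))) (by
          rw [← QuotientGroup.eq, ← QuotientGroup.mk'_apply, ← P.aug_app, hk]
          exact (hσ _).symm)
      refine ⟨k * m, ?_, ?_⟩
      · rw [map_mul, hk, hm, mul_one]
      · rw [map_mul, hmk, mul_inv_cancel_left]
  refine ⟨β, fun x => ?_, fun x => ?_⟩
  · exact DFunLike.congr_fun ((b 0).ext_hom ((P.α.app 0).comp β) (MonoidHom.id _)
      fun i => (hβ i).1) x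
  · exact DFunLike.congr_fun ((b 0).ext_hom (P.K.aug.comp β) (σ.comp P.L.aug)
      fun i => (hβ i).2) x

/-- An extension of a section of `α₀` to degree one. -/
theorem exists_section_one (σ : G ⧸ N →* G) {β₀ : P.L.X.obj 0 →* P.K.X.obj 0}
    (h₀ : ∀ x, P.α.app 0 (β₀ x) = x) (hσ : ∀ x, P.K.aug (β₀ x) = σ (P.L.aug x)) :
    ∃ β : P.L.X.obj 1 →* P.K.X.obj 1, (∀ x, P.α.app 1 (β x) = x) ∧
      (∀ x, P.K.X.d 0 0 (β x) = β₀ (P.L.X.d 0 0 x)) ∧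
      ∀ x, P.K.X.d 0 1 (β x) = β₀ (P.L.X.d 0 1 x) := by
  obtain ⟨ι, b, -⟩ := P.L.isFree
  obtain ⟨β, hβ⟩ := (b 1).exists_hom
    (r := fun i y => P.α.app 1 y = b 1 i ∧ P.K.X.d 0 0 y = β₀ (P.L.X.d 0 0 (b 1 i)) ∧
      P.K.X.d 0 1 y = β₀ (P.L.X.d 0 1 (b 1 i))) fun i => by
      obtain ⟨k, hk⟩ := P.surjective 1 (b 1 i)
      have hα : ∀ j, P.α.app 0 ((P.K.X.d 0 j k)⁻¹ * β₀ (P.L.X.d 0 j (b 1 i))) = 1 := fun j => by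
        rw [map_mul, map_inv, P.α.app_d, hk, h₀, inv_mul_cancel]
      have haug : P.K.aug ((P.K.X.d 0 1 k)⁻¹ * β₀ (P.L.X.d 0 1 (b 1 i))) =
          P.K.aug ((P.K.X.d 0 0 k)⁻¹ * β₀ (P.L.X.d 0 0 (b 1 i))) := by
        simp only [map_mul, map_inv, hσ, FreeSimplicialResolution.aug_d_eq]
      -- Let `e_j` be the error of `k` at face `j`. The factor `s₀ e₀` repairs face 0 but multiplies
      -- face 1 by `e₀` as well; the remaining error `e₀⁻¹ e₁` lies in `ker α₀` with trivial
      -- augmentation, so it bounds within `ker α`.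
      obtain ⟨m, hm, hm0, hm1⟩ := P.exists_ker_boundary_zero
        (x := ((P.K.X.d 0 0 k)⁻¹ * β₀ (P.L.X.d 0 0 (b 1 i)))⁻¹ *
          ((P.K.X.d 0 1 k)⁻¹ * β₀ (P.L.X.d 0 1 (b 1 i))))
        (by rw [map_mul, map_inv, hα, hα, inv_one, mul_one])
        (by rw [map_mul, map_inv, haug, inv_mul_cancel])
      refine ⟨k * P.K.X.s 0 0 ((P.K.X.d 0 0 k)⁻¹ * β₀ (P.L.X.d 0 0 (b 1 i))) * m, ?_, ?_, ?_⟩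
      · rw [map_mul, map_mul, P.α.app_s, hα, hk, hm, map_one, mul_one, mul_one]
      · rw [map_mul, map_mul, P.K.d_zero_s, hm0, mul_one, mul_inv_cancel_left]
      · rw [map_mul, map_mul, P.K.d_one_s, hm1, mul_assoc, mul_inv_cancel_left,
          mul_inv_cancel_left]
  refine ⟨β, fun x => ?_, fun x => ?_, fun x => ?_⟩
  · exact DFunLike.congr_fun ((b 1).ext_hom ((P.α.app 1).comp β) (MonoidHom.id _)
      fun i => (hβ i).1) x
  · exact DFunLike.congr_fun ((b 1).ext_hom ((P.K.X.d 0 0).comp β) (β₀.comp (P.L.X.d 0 0))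
      fun i => (hβ i).2.1) x
  · exact DFunLike.congr_fun ((b 1).ext_hom ((P.K.X.d 0 1).comp β) (β₀.comp (P.L.X.d 0 1))
      fun i => (hβ i).2.2) x

theorem exists_section (hN : ∃ Q : Subgroup G, N.IsComplement' Q) :
    ∃ (β₀ : P.L.X.obj 0 →* P.K.X.obj 0) (β₁ : P.L.X.obj 1 →* P.K.X.obj 1),
      (∀ x, P.α.app 0 (β₀ x) = x) ∧ (∀ x, P.α.app 1 (β₁ x) = x) ∧
      (∀ x, P.K.X.d 0 0 (β₁ x) = β₀ (P.L.X.d 0 0 x)) ∧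
      ∀ x, P.K.X.d 0 1 (β₁ x) = β₀ (P.L.X.d 0 1 x) := by
  obtain ⟨Q, hQ⟩ := hN
  obtain ⟨σ, hσ⟩ := hQ.exists_section
  obtain ⟨β₀, h₀, hσ₀⟩ := P.exists_section_zero σ hσ
  obtain ⟨β₁, h₁⟩ := P.exists_section_one σ h₀ hσ₀
  exact ⟨β₀, β₁, h₀, h₁⟩

end PairResolution

/-! ### The Baer invariant of a pair -/

namespace PairResolution

variable {G : Type u} [Group G] {N : Subgroup G} [N.Normal] (P : PairResolution N)
  (V : Set (FreeGroup ℕ))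

theorem map_mem_starSubgroup_ker_aug {x : P.K.X.obj 0}
    (hx : x ∈ starSubgroup V (N.comap P.K.aug)) :
    P.α.app 0 x ∈ starSubgroup V P.L.aug.ker := by
  refine starSubgroup_le_comap (N := P.L.aug.ker) (P.α.app 0) (fun a ha => ?_) hx
  rw [Subgroup.mem_comap, MonoidHom.mem_ker, P.aug_app]
  exact (QuotientGroup.eq_one_iff _).2 ha

/-- The preimage of `[ker aug V* L₀]` in `V(K₀)` is `[S V* K₀]`, where `S` is the preimage
of `N`. -/
theorem mem_starSubgroup_comap_of_map_mem {β : P.L.X.obj 0 →* P.K.X.obj 0}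
    (hβ : ∀ x, P.α.app 0 (β x) = x) {x : P.K.X.obj 0} (hx : x ∈ verbalSubgroup V (P.K.X.obj 0))
    (hαx : P.α.app 0 x ∈ starSubgroup V P.L.aug.ker) :
    x ∈ starSubgroup V (N.comap P.K.aug) := by
  have hmem : ∀ a, P.L.aug (P.α.app 0 a) = 1 → a ∈ N.comap P.K.aug := fun a ha => by
    rw [P.aug_app] at ha
    exact (QuotientGroup.eq_one_iff (P.K.aug a)).1 ha
  obtain ⟨c, hc, hcx⟩ := starSubgroup_le_map (V := V) (P.α.app 0) (P.surjective 0)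
    (M := N.comap P.K.aug) (N := P.L.aug.ker) (fun t ht => by
      obtain ⟨a, rfl⟩ := P.surjective 0 t
      exact ⟨a, hmem a ht, rfl⟩) hαx
  -- The error of the lift `c` lies in `ker α₀ ∩ V(K₀)`, and `α₀` splits.
  have hcx' : c⁻¹ * x ∈ starSubgroup V (P.α.app 0).ker := by
    refine ker_inf_verbalSubgroup_le (P.α.app 0) β hβ (Subgroup.mem_inf.2 ⟨?_, ?_⟩)
    · rw [MonoidHom.mem_ker, map_mul, map_inv, hcx, inv_mul_cancel]
    · exact mul_mem (inv_mem (starSubgroup_le_verbalSubgroup _ hc)) hx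
  have hle : (P.α.app 0).ker ≤ N.comap P.K.aug := fun a ha => hmem a (by
    rw [MonoidHom.mem_ker] at ha
    rw [ha, map_one])
  simpa using mul_mem hc (starSubgroup_mono hle hcx')

/-- The elements of `K₁` with trivial zeroth face that represent cycles of the kernel of
`α / V(α)`. -/
def relativeCycles : Subgroup (P.K.X.obj 1) :=
  (P.K.X.d 0 0).ker ⊓ ((verbalSubgroup V (P.L.X.obj 1)).comap (P.α.app 1) ⊓
    (verbalSubgroup V (P.K.X.obj 0)).comap (P.K.X.d 0 1))

/-- The class of an element of `P.relativeCycles V` in the kernel of `α / V(α)`. -/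
def toKer : P.relativeCycles V →* (P.α.modVerbal V).ker.obj 1 :=
  MonoidHom.codRestrict
    ((QuotientGroup.mk' (verbalSubgroup V (P.K.X.obj 1))).comp (P.relativeCycles V).subtype :
      P.relativeCycles V →* (P.K.X.modVerbal V).obj 1)
    ((P.α.modVerbal V).app 1).ker fun x => (QuotientGroup.eq_one_iff _).2 x.2.2.1

/-- The class of an element of `P.relativeCycles V` as a cycle of the kernel of `α / V(α)`. -/
def toCycles : P.relativeCycles V →* (P.α.modVerbal V).ker.cycles 1 :=
  (P.toKer V).codRestrict _ fun x => SimplicialGroup.mem_cycles_one.2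
    ⟨Subtype.ext (congrArg QuotientGroup.mk x.2.1),
      Subtype.ext ((QuotientGroup.eq_one_iff _).2 x.2.2.2)⟩

/-- The class of an element of `P.relativeCycles V` in the Baer invariant. -/
def toBaerInvariant : P.relativeCycles V →* P.baerInvariant V :=
  (QuotientGroup.mk' _).comp (P.toCycles V)

theorem toBaerInvariant_surjective : Function.Surjective (P.toBaerInvariant V) := by
  refine (QuotientGroup.mk'_surjective _).comp ?_
  rintro ⟨⟨⟨k⟩, hα⟩, hk⟩
  obtain ⟨h0, h1⟩ := SimplicialGroup.mem_cycles_one.1 hk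
  have hα' : P.α.app 1 k ∈ verbalSubgroup V _ := (QuotientGroup.eq_one_iff _).1 hα
  have h0' : P.K.X.d 0 0 k ∈ verbalSubgroup V _ :=
    (QuotientGroup.eq_one_iff _).1 (congrArg Subtype.val h0)
  have h1' : P.K.X.d 0 1 k ∈ verbalSubgroup V _ :=
    (QuotientGroup.eq_one_iff _).1 (congrArg Subtype.val h1)
  -- Dividing `k` by this verbal degenerate element keeps its class and makes the zeroth face
  -- trivial on the nose.
  have hs : P.K.X.s 0 0 (P.K.X.d 0 0 k) ∈ verbalSubgroup V (P.K.X.obj 1) :=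
    verbalSubgroup_le_comap V _ h0'
  refine ⟨⟨k * (P.K.X.s 0 0 (P.K.X.d 0 0 k))⁻¹,
    Subgroup.mem_inf.2 ⟨?_, Subgroup.mem_inf.2 ⟨?_, ?_⟩⟩⟩, ?_⟩
  · rw [MonoidHom.mem_ker, map_mul, map_inv, P.K.d_zero_s, mul_inv_cancel]
  · exact mul_mem (by exact hα') (verbalSubgroup_le_comap V (P.α.app 1) (inv_mem hs))
  · exact mul_mem (by exact h1') (verbalSubgroup_le_comap V (P.K.X.d 0 1) (inv_mem hs))
  · refine Subtype.ext (Subtype.ext ?_)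
    refine QuotientGroup.eq.2 ?_
    simpa using hs

theorem toBaerInvariant_eq_one_iff (x : P.relativeCycles V) :
    P.toBaerInvariant V x = 1 ↔
      ∃ u : P.K.X.obj 2, P.α.app 2 u ∈ verbalSubgroup V (P.L.X.obj 2) ∧
        P.K.X.d 1 0 u ∈ verbalSubgroup V (P.K.X.obj 1) ∧
        P.K.X.d 1 1 u ∈ verbalSubgroup V (P.K.X.obj 1) ∧
        (P.K.X.d 1 2 u)⁻¹ * x ∈ verbalSubgroup V (P.K.X.obj 1) := by
  refine (QuotientGroup.eq_one_iff _).trans (SimplicialGroup.mem_boundaries_one.trans ?_)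
  constructor
  · rintro ⟨⟨⟨u⟩, hα⟩, h0, h1, h2⟩
    exact ⟨u, (QuotientGroup.eq_one_iff _).1 hα,
      (QuotientGroup.eq_one_iff _).1 (congrArg Subtype.val h0),
      (QuotientGroup.eq_one_iff _).1 (congrArg Subtype.val h1),
      QuotientGroup.eq.1 (congrArg Subtype.val h2)⟩
  · rintro ⟨u, hα, h0, h1, h2⟩
    exact ⟨⟨QuotientGroup.mk u, (QuotientGroup.eq_one_iff _).2 hα⟩,
      Subtype.ext ((QuotientGroup.eq_one_iff _).2 h0),
      Subtype.ext ((QuotientGroup.eq_one_iff _).2 h1),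
      Subtype.ext (QuotientGroup.eq.2 h2)⟩

theorem d_one_mem_of_toBaerInvariant_eq_one {x : P.relativeCycles V}
    (hx : P.toBaerInvariant V x = 1) : P.K.X.d 0 1 x ∈ starSubgroup V P.K.aug.ker := by
  obtain ⟨u, -, hu0, hu1, hu2⟩ := (P.toBaerInvariant_eq_one_iff V x).1 hx
  have hx0' : P.K.X.d 0 0 x = 1 := x.2.1
  have e00 := P.K.X.d_d 0 0 0 (by decide) u
  have e01 := P.K.X.d_d 0 1 0 (by decide) u
  have e11 := P.K.X.d_d 0 1 1 (by decide) u
  change P.K.X.d 0 0 (P.K.X.d 1 1 u) = P.K.X.d 0 0 (P.K.X.d 1 0 u) at e00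
  change P.K.X.d 0 0 (P.K.X.d 1 2 u) = P.K.X.d 0 1 (P.K.X.d 1 0 u) at e01
  change P.K.X.d 0 1 (P.K.X.d 1 2 u) = P.K.X.d 0 1 (P.K.X.d 1 1 u) at e11
  -- All factors are verbal. The simplicial identities cancel the faces of `u`, with the degenerate
  -- factor absorbing `d₁ d₀ u`, so the product has faces `1` and `d₁ x`.
  refine P.K.mem_starSubgroup_ker_aug.2 ⟨P.K.X.s 0 0 (P.K.X.d 0 1 (P.K.X.d 1 0 u)) *
    (P.K.X.d 1 0 u)⁻¹ * P.K.X.d 1 1 u * ((P.K.X.d 1 2 u)⁻¹ * x), ?_, ?_, ?_⟩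
  · refine mul_mem (mul_mem (mul_mem ?_ (inv_mem hu0)) hu1) hu2
    exact verbalSubgroup_le_comap V (P.K.X.s 0 0) (verbalSubgroup_le_comap V (P.K.X.d 0 1) hu0)
  · simp only [map_mul, map_inv, P.K.d_zero_s, e00, e01, hx0']
    group
  · simp only [map_mul, map_inv, P.K.d_one_s, e11]
    group

/-- The only place where compatibility of the sections with the faces is used. -/
theorem toBaerInvariant_eq_one_of_d_one_mem (hN : ∃ Q : Subgroup G, N.IsComplement' Q)
    {x : P.relativeCycles V} (hx : P.K.X.d 0 1 x ∈ starSubgroup V P.K.aug.ker) :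
    P.toBaerInvariant V x = 1 := by
  refine (P.toBaerInvariant_eq_one_iff V x).2 ?_
  obtain ⟨β₀, β₁, -, h₁, hd0, hd1⟩ := P.exists_section hN
  obtain ⟨z, hz, hz0, hz1⟩ := P.K.mem_starSubgroup_ker_aug.1 hx
  have hx0 : P.K.X.d 0 0 x = 1 := x.2.1
  have hw : β₁ (P.α.app 1 (x * z⁻¹)) ∈ verbalSubgroup V (P.K.X.obj 1) := by
    refine verbalSubgroup_le_comap V β₁ ?_
    rw [map_mul]
    exact mul_mem x.2.2.1 (verbalSubgroup_le_comap V (P.α.app 1) (inv_mem hz))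
  -- Here `x z⁻¹` is a cycle of `K`. Its reflection `β₁ α (x z⁻¹)` is verbal and again a cycle, so
  -- the quotient is a cycle of `ker α`, equal to `x` modulo `V(K₁)`.
  obtain ⟨u, huα, hu0, hu1, hu2⟩ := P.exists_ker_boundary_one
    (q := x * z⁻¹ * (β₁ (P.α.app 1 (x * z⁻¹)))⁻¹)
    (by rw [map_mul, map_inv, h₁, mul_inv_cancel])
    (by simp only [map_mul, map_inv, hd0, ← P.α.app_d, hx0, hz0, inv_one, mul_one,
      map_one])
    (by simp only [map_mul, map_inv, hd1, ← P.α.app_d, hz1, mul_inv_cancel, inv_one,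
      mul_one])
  refine ⟨u, ?_, ?_, ?_, ?_⟩
  · rw [huα]
    exact one_mem _
  · rw [hu0]
    exact one_mem _
  · rw [hu1]
    exact one_mem _
  · rw [hu2]
    simpa [mul_assoc] using mul_mem hw hz

/-- The first face sends `P.relativeCycles V` into `R ∩ [S V* K₀]`. -/
theorem d_one_mem_of_mem_relativeCycles {β : P.L.X.obj 0 →* P.K.X.obj 0}
    (hβ : ∀ x, P.α.app 0 (β x) = x) {x : P.K.X.obj 1} (hx : x ∈ P.relativeCycles V) :
    P.K.X.d 0 1 x ∈ P.K.aug.ker ⊓ starSubgroup V (N.comap P.K.aug) := by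
  obtain ⟨h0, hα, h1⟩ := hx
  have h0' : P.K.X.d 0 0 x = 1 := h0
  refine ⟨P.K.aug_d_one h0, P.mem_starSubgroup_comap_of_map_mem V hβ h1 ?_⟩
  exact P.L.mem_starSubgroup_ker_aug.2
    ⟨P.α.app 1 x, hα, by rw [← P.α.app_d, h0', map_one], (P.α.app_d 0 1 x).symm⟩

/-- Every element of `R ∩ [S V* K₀]` is a first face of an element of `P.relativeCycles V`. -/
theorem exists_mem_relativeCycles {y : P.K.X.obj 0}
    (hy : y ∈ P.K.aug.ker ⊓ starSubgroup V (N.comap P.K.aug)) :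
    ∃ x ∈ P.relativeCycles V, P.K.X.d 0 1 x = y := by
  obtain ⟨hR, hS⟩ := hy
  obtain ⟨t, ht, ht0, ht1⟩ := P.L.mem_starSubgroup_ker_aug.1
    (P.map_mem_starSubgroup_ker_aug V hS)
  obtain ⟨k, hk0, rfl⟩ := P.K.exists_of_aug_eq_one hR
  -- Since `α k` and `t` have the same faces, they differ by a boundary of `L`. Removing a lift of
  -- it from `k` makes the image equal to the verbal element `t` and keeps the faces.
  obtain ⟨u, hu0, hu1, hu2⟩ := P.L.exists_of_cycle_one (x := P.α.app 1 k * t⁻¹)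
    (by rw [map_mul, map_inv, ← P.α.app_d, hk0, ht0, map_one, inv_one, mul_one])
    (by rw [map_mul, map_inv, ← P.α.app_d, ht1, mul_inv_cancel])
  obtain ⟨u, rfl, hu0, hu1⟩ := P.exists_lift_one hu0 hu1
  have e1 : P.K.X.d 0 1 ((P.K.X.d 1 2 u)⁻¹ * k) = P.K.X.d 0 1 k := by
    rw [map_mul, map_inv, P.K_d_one_d_two hu1, inv_one, one_mul]
  refine ⟨(P.K.X.d 1 2 u)⁻¹ * k,
    Subgroup.mem_inf.2 ⟨?_, Subgroup.mem_inf.2 ⟨?_, ?_⟩⟩, e1⟩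
  · rw [MonoidHom.mem_ker, map_mul, map_inv, P.K_d_zero_d_two hu0, hk0,
      inv_one, one_mul]
  · rw [Subgroup.mem_comap, map_mul, map_inv, P.α.app_d, hu2, mul_inv_rev,
      inv_inv, inv_mul_cancel_right]
    exact ht
  · rw [Subgroup.mem_comap, e1]
    exact starSubgroup_le_verbalSubgroup _ hS

end PairResolution

/-! ### Comparison of free presentations and the main isomorphism -/

/-- A free group maps to any group over a third one onto which the latter surjects. -/
theorem IsFreeGroup.exists_lift {F : Type*} [Group F] [IsFreeGroup F] {X G : Type*} [Group X]
    [Group G] (p : F →* G) (q : X →* G) (hq : Function.Surjective q) :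
    ∃ f : F →* X, ∀ x, q (f x) = p x := by
  obtain ⟨f, hf⟩ := (IsFreeGroup.basis F).exists_hom
    (r := fun i y => q y = p (IsFreeGroup.basis F i)) fun i => hq _
  exact ⟨f, DFunLike.congr_fun ((IsFreeGroup.basis F).ext_hom (q.comp f) p hf)⟩

theorem PairResolution.nonempty_mulEquiv (V : Set (FreeGroup ℕ)) {G : Type u} [Group G]
    {N : Subgroup G} [N.Normal] (hN : ∃ Q : Subgroup G, N.IsComplement' Q)
    {F : Type v} [Group F] [IsFreeGroup F] (p : F →* G) (hp : Function.Surjective p)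
    (P : PairResolution N) :
    Nonempty (P.baerInvariant V ≃*
        ↥(p.ker ⊓ starSubgroup V (N.comap p)) ⧸
          (starSubgroup V p.ker).subgroupOf (p.ker ⊓ starSubgroup V (N.comap p))) := by
  obtain ⟨β₀, -, h₀, -⟩ := P.exists_section hN
  have hfree : IsFreeGroup (P.K.X.obj 0) := by
    obtain ⟨ι, b, -⟩ := P.K.isFree
    exact (b 0).isFreeGroup
  obtain ⟨φ, hφ⟩ := IsFreeGroup.exists_lift P.K.aug p hp
  obtain ⟨ψ, hψ⟩ := IsFreeGroup.exists_lift p P.K.aug P.K.aug_surjective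
  have hφstar : starSubgroup V P.K.aug.ker ≤ (starSubgroup V p.ker).comap φ :=
    starSubgroup_le_comap φ fun a ha => (hφ a).trans ha
  have hψstar : starSubgroup V p.ker ≤ (starSubgroup V P.K.aug.ker).comap ψ :=
    starSubgroup_le_comap ψ fun a ha => (hψ a).trans ha
  have hφS : starSubgroup V (N.comap P.K.aug) ≤ (starSubgroup V (N.comap p)).comap φ :=
    starSubgroup_le_comap φ fun a ha => by
      rw [Subgroup.mem_comap, Subgroup.mem_comap, hφ]
      exact ha
  have hψS : starSubgroup V (N.comap p) ≤ (starSubgroup V (N.comap P.K.aug)).comap ψ :=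
    starSubgroup_le_comap ψ fun a ha => by
      rw [Subgroup.mem_comap, Subgroup.mem_comap, hψ]
      exact ha
  have hmem : ∀ x : P.relativeCycles V,
      φ (P.K.X.d 0 1 x) ∈ p.ker ⊓ starSubgroup V (N.comap p) := fun x => by
    obtain ⟨hR, hS⟩ := P.d_one_mem_of_mem_relativeCycles V h₀ x.2
    exact ⟨(hφ _).trans hR, hφS hS⟩
  let g : P.relativeCycles V →* ↥(p.ker ⊓ starSubgroup V (N.comap p)) :=
    ((φ.comp (P.K.X.d 0 1)).comp (P.relativeCycles V).subtype).codRestrict _ hmem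
  refine MonoidHom.nonempty_mulEquiv_of_ker_eq (P.toBaerInvariant V)
    ((QuotientGroup.mk' ((starSubgroup V p.ker).subgroupOf
      (p.ker ⊓ starSubgroup V (N.comap p)))).comp g) (P.toBaerInvariant_surjective V) ?_ ?_
  · intro y
    obtain ⟨⟨y, hyR, hyS⟩, rfl⟩ := QuotientGroup.mk'_surjective _ y
    obtain ⟨x, hx, hxy⟩ := P.exists_mem_relativeCycles V (y := ψ y) ⟨(hψ y).trans hyR, hψS hyS⟩
    refine ⟨⟨x, hx⟩, QuotientGroup.eq.2 ?_⟩
    change (φ (P.K.X.d 0 1 x))⁻¹ * y ∈ starSubgroup V p.ker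
    rw [hxy]
    -- Both maps lie over `G`, so they agree modulo `ker p`, and hence on `V(F)` modulo its star
    -- subgroup.
    have h := map_mul_inv_map_mem_starSubgroup (N := p.ker) (V := V) (φ.comp ψ) (MonoidHom.id F)
      (fun a => by simp [MonoidHom.mem_ker, hφ, hψ])
      (inv_mem (starSubgroup_le_verbalSubgroup _ hyS))
    simpa using h
  · ext x
    rw [MonoidHom.mem_ker, MonoidHom.mem_ker]
    have hker : ((QuotientGroup.mk' ((starSubgroup V p.ker).subgroupOf
        (p.ker ⊓ starSubgroup V (N.comap p)))).comp g) x = 1 ↔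
        φ (P.K.X.d 0 1 x) ∈ starSubgroup V p.ker := QuotientGroup.eq_one_iff _
    rw [hker]
    refine ⟨fun h => hφstar (P.d_one_mem_of_toBaerInvariant_eq_one V h), fun h => ?_⟩
    refine P.toBaerInvariant_eq_one_of_d_one_mem V hN ?_
    have h' := map_mul_inv_map_mem_starSubgroup (N := P.K.aug.ker) (V := V)
      (MonoidHom.id (P.K.X.obj 0)) (ψ.comp φ)
      (fun a => by simp [MonoidHom.mem_ker, hφ, hψ])
      (starSubgroup_le_verbalSubgroup _ (P.d_one_mem_of_mem_relativeCycles V h₀ x.2).2)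
    simpa using mul_mem h' (hψstar h)

/-- Resolution data of the pair `(G, N)` exist, and with any choice of them the Baer invariant
`𝒱M(G, N)` is isomorphic to `(R ∩ [S V* F]) / [R V* F]`. Here `F` is a free group with an
epimorphism `p` onto `G`, `R = ker p`, and `S = p⁻¹(N)`. -/
theorem corollary3p4 (V : Set (FreeGroup ℕ)) {G : Type u} [Group G] (N : Subgroup G) [N.Normal]
    (hN : ∃ Q : Subgroup G, N.IsComplement' Q)
    {F : Type v} [Group F] [IsFreeGroup F] (p : F →* G) (hp : Function.Surjective p) :
    Nonempty (PairResolution N) ∧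
    ∀ P : PairResolution N,
      Nonempty (P.baerInvariant V ≃*
        ↥(p.ker ⊓ starSubgroup V (N.comap p)) ⧸
          (starSubgroup V p.ker).subgroupOf (p.ker ⊓ starSubgroup V (N.comap p))) := by
  exact ⟨⟨freeTower.pairResolution N⟩, fun P => P.nonempty_mulEquiv V hN p hp⟩
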